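/- Let $G=(V,E)$ be an undirected graph with $p$ vertices (no loops) and let $\sigma:V\to\{1,\dots,p\}$ be an ordering (a bijection). Write $i\sim j$ if $\{\sigma^{-1}(i),\sigma^{-1}(j)\}\in E$. Let $\mathbb P_{G_\sigma}$ be the cone of symmetric positive definite real $p\times p$ matrices $\Omega$ with $\Omega_{ij}=0$ whenever $i\ne j$ and $i\not\sim j$, and let $d\Omega$ be Lebesgue measure in the free entries $\Omega_{ij}$ ($i\ge j$, with $i=j$ or $i\sim j$). Every positive definite $\Omega$ has a unique decomposition $\Omega=LDL^{T}$ with $L$ lower triangular with unit diagonal and $D$ diagonal with positive diagonal entries $D_{ii}(\Omega)$. Let $U$ be a symmetric positive definite real $p\times p$ matrix and let $\delta_1,\dots,\delta_p>4$. The generalized $G$-Wishart distribution with parameters $(U,\delta)$ is the distribution on $\mathbb P_{G_\sigma}$ whose density with respect to $d\Omega$ is proportional to $$\Big(\prod_{i=1}^p D_{ii}(\Omega)^{\delta_i/2}\Big)\exp\Big(-\tfrac12\operatorname{tr}(\Omega U)\Big).$$ For $1\le k\le p$ let $\Omega_k$ be the leading $k\times k$ principal submatrix of $\Omega$, let $[\Omega_k^{-1}]^0$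 be the $p\times p$ matrix that has $\Omega_k^{-1}$ as its leading $k\times k$ block and zeros elsewhere, and put $\delta_{p+1}=0$. For a $p\times p$ matrix $A$ let $A_{G_\sigma}$ be the matrix with $(A_{G_\sigma})_{ij}=A_{ij}$ if $i=j$ or $i\sim j$, and $(A_{G_\sigma})_{ij}=0$ otherwise. Then this density can be normalized to a probability density. If $\Omega$ has the generalized $G$-Wishart distribution with parameters $(U,\delta)$ and $$\Sigma^*=\sum_{k=1}^p(\delta_k-\delta_{k+1})\,[\Omega_k^{-1}]^0,$$ then all entries of $\Sigma^*$ are integrable, and $$\big(E[\Sigma^*]\big)_{G_\sigma}=U_{G_\sigma},$$ that is, $E[\Sigma^*_{ij}]=U_{ij}$ whenever $i=j$ or $i\sim j$. In particular, if all $\delta_k$ are equal to one number $\delta$, then $(\Omega^{-1})_{ij}$ is integrable and $E[(\Omega^{-1})_{ij}]=U_{ij}/\delta$ whenever $i=j$ or $i\sim j$. -/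

import Mathlib

open MeasureTheory ProbabilityTheory Matrix

noncomputable section

/-- The ordered graph `G_σ` on `{0, …, p - 1}`: `i` and `j` are adjacent iff `σ⁻¹ i` and `σ⁻¹ j`
are adjacent in `G`. -/
def orderedGraph {V : Type*} {p : ℕ} (G : SimpleGraph V) (σ : V ≃ Fin p) :
    SimpleGraph (Fin p) :=
  G.comap σ.symm

/-- The cone of symmetric positive definite matrices `Ω` whose off-diagonal entry `Ω i j` vanishes
whenever `i` and `j` are not adjacent in `H`. -/
def PDCone {p : ℕ} (H : SimpleGraph (Fin p)) : Set (Matrix (Fin p) (Fin p) ℝ) :=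
  {Ω | Ω.PosDef ∧ ∀ i j, i ≠ j → ¬ H.Adj i j → Ω i j = 0}

/-- `Ω = L D Lᵀ` is the modified Cholesky decomposition of `Ω`: `L` is lower triangular with unit
diagonal, and `D` is diagonal with positive diagonal entries `d`. -/
structure IsModifiedCholesky {p : ℕ} (Ω L : Matrix (Fin p) (Fin p) ℝ) (d : Fin p → ℝ) :
    Prop where
  lower : ∀ i j, i < j → L i j = 0
  unit_diag : ∀ i, L i i = 1
  pos : ∀ i, 0 < d i
  eq : Ω = L * Matrix.diagonal d * Lᵀ

open Classical in
/-- The diagonal entries `D_ii(Ω)` of the modified Cholesky decomposition (and `0` for a matrix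
that has none). -/
def choleskyD {p : ℕ} (Ω : Matrix (Fin p) (Fin p) ℝ) : Fin p → ℝ :=
  if h : ∃ d : Fin p → ℝ, ∃ L, IsModifiedCholesky Ω L d then h.choose else 0

/-- Every positive definite matrix has a modified Cholesky decomposition, -/
theorem exists_isModifiedCholesky {p : ℕ} {Ω : Matrix (Fin p) (Fin p) ℝ} (hΩ : Ω.PosDef) :
    ∃ d : Fin p → ℝ, ∃ L, IsModifiedCholesky Ω L d := by
  have hB : Matrix.BlockTriangular (LDL.lower hΩ) OrderDual.toDual :=
    Matrix.blockTriangular_inv_of_blockTriangular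
      (fun i j hij => LDL.lowerInv_triangular hΩ hij)
  have hdet : (LDL.lower hΩ).det ≠ 0 := by
    have h := Matrix.isUnit_det_of_invertible (LDL.lowerInv hΩ)
    have h2 := Matrix.isUnit_nonsing_inv_det _ h
    exact h2.ne_zero
  have he : ∀ i, LDL.lower hΩ i i ≠ 0 := by
    rw [Matrix.det_of_isLowerTriangular _ hB] at hdet
    exact fun i => Finset.prod_ne_zero_iff.1 hdet i (Finset.mem_univ i)
  have hpos : ∀ i, 0 < LDL.diagEntries hΩ i := by
    have h : (LDL.diag hΩ).PosDef := by
      rw [LDL.diag_eq_lowerInv_conj]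
      exact hΩ.mul_mul_conjTranspose_same
        (Matrix.vecMul_injective_of_isUnit (isUnit_of_invertible (LDL.lowerInv hΩ)))
    exact Matrix.posDef_diagonal_iff.1 h
  refine ⟨fun j => LDL.diagEntries hΩ j * LDL.lower hΩ j j ^ 2,
    LDL.lower hΩ * Matrix.diagonal (fun j => (LDL.lower hΩ j j)⁻¹), ?_, ?_, ?_, ?_⟩
  · intro i j hij
    rw [Matrix.mul_diagonal, hB (by exact hij), zero_mul]
  · intro i
    rw [Matrix.mul_diagonal, mul_inv_cancel₀ (he i)]
  · intro i
    have := he i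
    have := hpos i
    positivity
  · conv_lhs => rw [← LDL.lower_conj_diag hΩ]
    rw [Matrix.transpose_mul, Matrix.diagonal_transpose, LDL.diag]
    simp only [Matrix.mul_assoc, Matrix.conjTranspose_eq_transpose_of_trivial]
    rw [← Matrix.mul_assoc (Matrix.diagonal _) (Matrix.diagonal _) (_ᵀ),
      ← Matrix.mul_assoc (Matrix.diagonal _) (Matrix.diagonal _ * _) (_ᵀ),
      Matrix.diagonal_mul_diagonal, Matrix.diagonal_mul_diagonal]
    congr 3
    ext i
    have := he i
    field_simp

/-- and the diagonal part is determined by the matrix. -/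
theorem IsModifiedCholesky.choleskyD_eq {p : ℕ} {Ω L : Matrix (Fin p) (Fin p) ℝ}
    {d : Fin p → ℝ} (h : IsModifiedCholesky Ω L d) : choleskyD Ω = d := by
  have key : ∀ (M : Matrix (Fin p) (Fin p) ℝ) (e : Fin p → ℝ), IsModifiedCholesky Ω M e →
      ∀ i j, Ω i j = ∑ k ∈ Finset.univ.filter (· < j), M i k * e k * M j k + M i j * e j := by
    intro M e h i j
    have h1 : Ω i j = ∑ k, M i k * e k * M j k := by
      conv_lhs => rw [h.eq]
      rw [Matrix.mul_apply]
      simp only [Matrix.mul_diagonal, Matrix.transpose_apply]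
    rw [h1, ← Finset.sum_filter_add_sum_filter_not Finset.univ (· < j)]
    congr 1
    rw [Finset.sum_eq_single j]
    · rw [h.unit_diag, mul_one]
    · intro k hk hkj
      rw [h.lower j k (lt_of_le_of_ne (not_lt.1 (Finset.mem_filter.1 hk).2) hkj.symm), mul_zero]
    · intro hj
      simp at hj
  have hex : ∃ d : Fin p → ℝ, ∃ L, IsModifiedCholesky Ω L d := ⟨d, L, h⟩
  have hD : choleskyD Ω = hex.choose := by
    rw [choleskyD, dif_pos hex]
  obtain ⟨M, hM⟩ := hex.choose_spec
  rw [hD]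
  generalize hex.choose = e at hM
  have main : ∀ j, e j = d j ∧ ∀ i, M i j = L i j := by
    intro j
    induction j using WellFoundedLT.induction with
    | ind j ih =>
      have hs : ∀ i, ∑ k ∈ Finset.univ.filter (· < j), M i k * e k * M j k =
          ∑ k ∈ Finset.univ.filter (· < j), L i k * d k * L j k := by
        intro i
        refine Finset.sum_congr rfl fun k hk => ?_
        obtain ⟨h1, h2⟩ := ih k (Finset.mem_filter.1 hk).2
        rw [h1, h2, h2]
      have hm : ∀ i, M i j * e j = L i j * d j := by
        intro i
        have h1 := key M e hM i j
        have h2 := key L d h i j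
        rw [hs i] at h1
        linarith
      have hj : e j = d j := by
        have := hm j
        rwa [hM.unit_diag, h.unit_diag, one_mul, one_mul] at this
      refine ⟨hj, fun i => ?_⟩
      have := hm i
      rw [hj] at this
      exact mul_right_cancel₀ (h.pos j).ne' this
  exact funext fun j => (main j).1

/-- The unnormalized generalized G-Wishart density
`(∏ i, D_ii(Ω) ^ (δ_i / 2)) * exp (- tr (Ω U) / 2)`. -/
def wishartDensity {p : ℕ} (U : Matrix (Fin p) (Fin p) ℝ) (δ : Fin p → ℝ)
    (Ω : Matrix (Fin p) (Fin p) ℝ) : ℝ :=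
  (∏ i, choleskyD Ω i ^ (δ i / 2)) * Real.exp (-(1 / 2) * (Ω * U).trace)

/-- The positions `(i, j)` with `j ≤ i` at which a symmetric matrix with the zero pattern of `H`
has a free entry. -/
def FreePos {p : ℕ} (H : SimpleGraph (Fin p)) : Type :=
  {q : Fin p × Fin p // q.2 ≤ q.1 ∧ (q.1 = q.2 ∨ H.Adj q.1 q.2)}

instance freePosFinite {p : ℕ} (H : SimpleGraph (Fin p)) : Finite (FreePos H) :=
  inferInstanceAs (Finite {q : Fin p × Fin p // q.2 ≤ q.1 ∧ (q.1 = q.2 ∨ H.Adj q.1 q.2)})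

instance freePosFintype {p : ℕ} (H : SimpleGraph (Fin p)) : Fintype (FreePos H) :=
  Fintype.ofFinite _

open Classical in
/-- The symmetric matrix with the zero pattern of `H` that has given free entries. -/
def ofFree {p : ℕ} (H : SimpleGraph (Fin p)) (x : FreePos H → ℝ) :
    Matrix (Fin p) (Fin p) ℝ :=
  Matrix.of fun i j =>
    if h : j ≤ i ∧ (i = j ∨ H.Adj i j) then x ⟨(i, j), h⟩
    else if h : i ≤ j ∧ (j = i ∨ H.Adj j i) then x ⟨(j, i), h⟩
    else 0

/-- Matrices carry the product σ-algebra of their entries. -/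
instance matrixMeasurableSpace {p : ℕ} : MeasurableSpace (Matrix (Fin p) (Fin p) ℝ) :=
  inferInstanceAs (MeasurableSpace (Fin p → Fin p → ℝ))

theorem measurable_ofFree {p : ℕ} (H : SimpleGraph (Fin p)) : Measurable (ofFree H) := by
  refine measurable_pi_lambda _ fun i => measurable_pi_lambda _ fun j => ?_
  simp only [ofFree, Matrix.of_apply]
  split_ifs
  · exact measurable_pi_apply _
  · exact measurable_pi_apply _
  · exact measurable_const

/-- Lebesgue measure `dΩ` in the free entries, as a measure on matrices. -/
def freeLebesgue {p : ℕ} (H : SimpleGraph (Fin p)) : Measure (Matrix (Fin p) (Fin p) ℝ) :=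
  Measure.map (ofFree H) volume

/-- The measure on `PDCone H` with density `wishartDensity U δ` with respect to `dΩ`. -/
def wishartMeasure {p : ℕ} (H : SimpleGraph (Fin p)) (U : Matrix (Fin p) (Fin p) ℝ)
    (δ : Fin p → ℝ) : Measure (Matrix (Fin p) (Fin p) ℝ) :=
  ((freeLebesgue H).restrict (PDCone H)).withDensity
    fun Ω => ENNReal.ofReal (wishartDensity U δ Ω)

/-- The generalized G-Wishart distribution with parameters `U` and `δ`: the normalization of
`wishartMeasure H U δ`. -/
def genGWishart {p : ℕ} (H : SimpleGraph (Fin p)) (U : Matrix (Fin p) (Fin p) ℝ)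
    (δ : Fin p → ℝ) : Measure (Matrix (Fin p) (Fin p) ℝ) :=
  (wishartMeasure H U δ Set.univ)⁻¹ • wishartMeasure H U δ

/-- The leading principal submatrix with the rows and columns `0, …, k` (the matrix written
`Ω_{k+1}` when rows and columns are numbered from 1). -/
def leadingSub {p : ℕ} (Ω : Matrix (Fin p) (Fin p) ℝ) (k : Fin p) :
    Matrix {i : Fin p // i ≤ k} {i : Fin p // i ≤ k} ℝ :=
  Ω.submatrix Subtype.val Subtype.val

/-- The inverse of that submatrix, padded by zeros to a `p × p` matrix. -/
def paddedInv {p : ℕ} (Ω : Matrix (Fin p) (Fin p) ℝ) (k : Fin p) :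
    Matrix (Fin p) (Fin p) ℝ :=
  Matrix.of fun i j =>
    if h : i ≤ k ∧ j ≤ k then (leadingSub Ω k)⁻¹ ⟨i, h.1⟩ ⟨j, h.2⟩ else 0

/-- The shape parameter after `δ k`, which is `0` after the last one. -/
def nextShape {p : ℕ} (δ : Fin p → ℝ) (k : Fin p) : ℝ :=
  if h : (k : ℕ) + 1 < p then δ ⟨(k : ℕ) + 1, h⟩ else 0

/-- The matrix `∑ k, (δ_k - δ_{k+1}) [Ω_k⁻¹]⁰`. -/
def sigmaStar {p : ℕ} (δ : Fin p → ℝ) (Ω : Matrix (Fin p) (Fin p) ℝ) :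
    Matrix (Fin p) (Fin p) ℝ :=
  ∑ k, (δ k - nextShape δ k) • paddedInv Ω k

open Classical in
/-- The projection `A ↦ A_{G_σ}`: keep the entries on the diagonal and on the edges, and
replace the other entries by `0`. -/
def graphPart {p : ℕ} (H : SimpleGraph (Fin p)) (A : Matrix (Fin p) (Fin p) ℝ) :
    Matrix (Fin p) (Fin p) ℝ :=
  Matrix.of fun i j => if i = j ∨ H.Adj i j then A i j else 0

/-- The entrywise expectation of a random matrix. -/
def matrixExpectation {S : Type*} [MeasurableSpace S] {p : ℕ} (P : Measure S)
    (M : S → Matrix (Fin p) (Fin p) ℝ) : Matrix (Fin p) (Fin p) ℝ :=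
  Matrix.of fun i j => ∫ s, M s i j ∂P

end

/-!
Gaussian elimination gives `det Ω_k = ∏ i ≤ k, D_i`, so the density is the exponential of
`∑ k, (δ_k - δ_{k+1}) / 2 * log (det Ω_k) - tr (Ω U) / 2`. By Jacobi's formula its logarithmic
derivative in a direction `E` with the sparsity pattern of the graph is `tr (E (Σ* - U)) / 2`.
Extended by zero outside the cone, the density stays differentiable along every line: with
`1 < s ≤ δ_i / 2` it is at most a constant times `|det Ω| ^ s`, which vanishes to first order on the
singular boundary. Integrating the derivative along lines therefore shows that `tr (E (Σ* - U))` has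
mean zero for every free direction `E`, and these traces determine the entries of `E[Σ*] - U` on the
diagonal and on the edges. The entries of `Ω_k⁻¹` are integrable because their pole `1 / det Ω_k`
only lowers the first `k` exponents `δ_i / 2` by one.
-/

/-! ### Leading principal minors and the modified Cholesky decomposition -/

section Triangular

variable {m n R : Type*} [Fintype n] [DecidableEq n]

theorem mul_diagonal_mul_transpose_apply [NonUnitalSemiring R] (A : Matrix m n R) (d : n → R)
    (i j : m) : (A * diagonal d * Aᵀ) i j = ∑ k, A i k * d k * A j k := by
  rw [mul_apply]
  simp only [mul_diagonal, transpose_apply]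

theorem det_mul_diagonal_mul_transpose [LinearOrder n] [CommRing R] {L : Matrix n n R}
    (hL : L.IsLowerTriangular) (hL_diag : ∀ i, L i i = 1) (d : n → R) :
    (L * diagonal d * Lᵀ).det = ∏ i, d i := by
  have hdet : L.det = 1 := by
    rw [det_of_isLowerTriangular L hL, Finset.prod_eq_one fun i _ => hL_diag i]
  rw [det_mul, det_mul, det_transpose, det_diagonal, hdet, one_mul, mul_one]

end Triangular

section Cholesky

variable {p : ℕ} {Ω L : Matrix (Fin p) (Fin p) ℝ} {d : Fin p → ℝ}

theorem IsModifiedCholesky.apply_eq_sum (h : IsModifiedCholesky Ω L d) (i j : Fin p) :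
    Ω i j = ∑ m, L i m * d m * L j m := by
  rw [← mul_diagonal_mul_transpose_apply, ← h.eq]

theorem IsModifiedCholesky.det_eq_prod (h : IsModifiedCholesky Ω L d) : Ω.det = ∏ i, d i := by
  rw [h.eq, det_mul_diagonal_mul_transpose (fun i j hij => h.lower i j hij) h.unit_diag]

theorem IsModifiedCholesky.leadingSub_eq (h : IsModifiedCholesky Ω L d) (k : Fin p) :
    leadingSub Ω k =
      leadingSub L k * diagonal (fun i : {i // i ≤ k} => d i) * (leadingSub L k)ᵀ := by
  ext i j
  rw [mul_diagonal_mul_transpose_apply, leadingSub, submatrix_apply, h.apply_eq_sum]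
  refine (Fintype.sum_of_injective _ Subtype.val_injective _ _ (fun m hm => ?_) fun m => rfl).symm
  have hkm : k < m := not_le.1 fun hmk => hm ⟨⟨m, hmk⟩, rfl⟩
  rw [h.lower i m (i.2.trans_lt hkm), zero_mul, zero_mul]

theorem IsModifiedCholesky.det_leadingSub_eq_prod (h : IsModifiedCholesky Ω L d) (k : Fin p) :
    (leadingSub Ω k).det = ∏ i : {i // i ≤ k}, d i := by
  have hL : (leadingSub L k).IsLowerTriangular := fun i j hij => h.lower i j hij
  rw [h.leadingSub_eq k, det_mul_diagonal_mul_transpose hL fun i => h.unit_diag i]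

theorem IsModifiedCholesky.le_diag (h : IsModifiedCholesky Ω L d) (i : Fin p) : d i ≤ Ω i i := by
  have h_nonneg : ∀ m ∈ Finset.univ, 0 ≤ L i m * d m * L i m := fun m _ => by
    rw [mul_right_comm]
    exact mul_nonneg (mul_self_nonneg _) (h.pos m).le
  calc d i = L i i * d i * L i i := by rw [h.unit_diag, one_mul, mul_one]
    _ ≤ ∑ m, L i m * d m * L i m := Finset.single_le_sum h_nonneg (Finset.mem_univ i)
    _ = Ω i i := (h.apply_eq_sum i i).symm

theorem exists_isModifiedCholesky_choleskyD (hΩ : Ω.PosDef) :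
    ∃ L, IsModifiedCholesky Ω L (choleskyD Ω) := by
  obtain ⟨d, L, h⟩ := exists_isModifiedCholesky hΩ
  exact ⟨L, h.choleskyD_eq ▸ h⟩

theorem choleskyD_pos (hΩ : Ω.PosDef) (i : Fin p) : 0 < choleskyD Ω i :=
  (exists_isModifiedCholesky_choleskyD hΩ).choose_spec.pos i

theorem choleskyD_le_diag (hΩ : Ω.PosDef) (i : Fin p) : choleskyD Ω i ≤ Ω i i :=
  (exists_isModifiedCholesky_choleskyD hΩ).choose_spec.le_diag i

theorem det_eq_prod_choleskyD (hΩ : Ω.PosDef) : Ω.det = ∏ i, choleskyD Ω i :=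
  (exists_isModifiedCholesky_choleskyD hΩ).choose_spec.det_eq_prod

theorem det_leadingSub_eq_prod_choleskyD (hΩ : Ω.PosDef) (k : Fin p) :
    (leadingSub Ω k).det = ∏ i, if i ≤ k then choleskyD Ω i else 1 := by
  rw [(exists_isModifiedCholesky_choleskyD hΩ).choose_spec.det_leadingSub_eq_prod,
    ← Finset.prod_filter]
  exact (Finset.prod_subtype _ (fun i => by simp only [Finset.mem_filter_univ]) _).symm

theorem posDef_leadingSub (hΩ : Ω.PosDef) (k : Fin p) : (leadingSub Ω k).PosDef :=
  hΩ.submatrix Subtype.val_injective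

end Cholesky

/-! ### The density and the leading principal minors -/

theorem sum_ite_shape_sub_nextShape {p : ℕ} (δ : Fin p → ℝ) (i : Fin p) :
    ∑ k, (if i ≤ k then δ k - nextShape δ k else 0) = δ i := by
  set a : ℕ → ℝ := fun n => if h : n < p then δ ⟨n, h⟩ else 0
  have h_shape (k : Fin p) : a k = δ k := dif_pos k.2
  calc ∑ k : Fin p, (if i ≤ k then δ k - nextShape δ k else 0)
      = ∑ k : Fin p, if (i : ℕ) ≤ k then a k - a (k + 1) else 0 := by
        simp only [h_shape, Fin.le_def]
        rfl
    _ = ∑ n ∈ Finset.range p with (i : ℕ) ≤ n, (a n - a (n + 1)) := by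
        rw [Fin.sum_univ_eq_sum_range fun n => if (i : ℕ) ≤ n then a n - a (n + 1) else 0,
          Finset.sum_filter]
    _ = ∑ n ∈ Finset.Ico (i : ℕ) p, (a n - a (n + 1)) := by
        congr 1
        ext n
        simp only [Finset.mem_filter, Finset.mem_range, Finset.mem_Ico, and_comm]
    _ = a i - a p := by
        rw [← neg_inj, ← Finset.sum_neg_distrib]
        simp only [neg_sub]
        exact Finset.sum_Ico_sub a i.2.le
    _ = δ i := by rw [h_shape, show a p = 0 from dif_neg (lt_irrefl p), sub_zero]

section Density

variable {p : ℕ} (U : Matrix (Fin p) (Fin p) ℝ) (δ : Fin p → ℝ) {Ω : Matrix (Fin p) (Fin p) ℝ}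

/-- The logarithm of `wishartDensity U δ` on positive definite matrices. It is written in terms of
leading principal minors rather than `choleskyD`, so that it is visibly measurable and
differentiable in the entries. -/
noncomputable def wishartLogDensity (Ω : Matrix (Fin p) (Fin p) ℝ) : ℝ :=
  ∑ k, (δ k - nextShape δ k) / 2 * Real.log (leadingSub Ω k).det - 1 / 2 * (Ω * U).trace

theorem wishartDensity_pos (hΩ : Ω.PosDef) : 0 < wishartDensity U δ Ω :=
  mul_pos (Finset.prod_pos fun i _ => Real.rpow_pos_of_pos (choleskyD_pos hΩ i) _)
    (Real.exp_pos _)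

theorem log_det_leadingSub (hΩ : Ω.PosDef) (k : Fin p) :
    Real.log (leadingSub Ω k).det = ∑ i, if i ≤ k then Real.log (choleskyD Ω i) else 0 := by
  have h_ne : ∀ i ∈ Finset.univ, (if i ≤ k then choleskyD Ω i else 1) ≠ 0 := fun i _ => by
    split_ifs
    exacts [(choleskyD_pos hΩ i).ne', one_ne_zero]
  simp only [det_leadingSub_eq_prod_choleskyD hΩ, Real.log_prod h_ne, apply_ite Real.log,
    Real.log_one]

theorem wishartDensity_eq_exp (hΩ : Ω.PosDef) :
    wishartDensity U δ Ω = Real.exp (wishartLogDensity U δ Ω) := by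
  have h_log : ∑ i, Real.log (choleskyD Ω i) * (δ i / 2) =
      ∑ k, (δ k - nextShape δ k) / 2 * Real.log (leadingSub Ω k).det := by
    simp only [log_det_leadingSub hΩ, Finset.mul_sum]
    rw [Finset.sum_comm]
    refine Finset.sum_congr rfl fun i _ => ?_
    rw [← sum_ite_shape_sub_nextShape δ i, Finset.sum_div, Finset.mul_sum]
    refine Finset.sum_congr rfl fun k _ => ?_
    split_ifs <;> ring
  rw [wishartLogDensity, ← h_log, wishartDensity, sub_eq_add_neg, Real.exp_add, Real.exp_sum,
    neg_mul]
  simp only [Real.rpow_def_of_pos (choleskyD_pos hΩ _)]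

theorem wishartDensity_eq_prod_rpow_mul (s : Fin p → ℝ) (hΩ : Ω.PosDef) :
    wishartDensity U δ Ω =
      (∏ i, choleskyD Ω i ^ s i) * wishartDensity U (fun i => δ i - 2 * s i) Ω := by
  rw [wishartDensity, wishartDensity, ← mul_assoc, ← Finset.prod_mul_distrib]
  congr 1
  refine Finset.prod_congr rfl fun i _ => ?_
  rw [← Real.rpow_add (choleskyD_pos hΩ i)]
  congr 1
  ring

end Density

/-! ### Positive definite matrices -/

section PosDef

variable {n : Type*}

section Finite

variable [Finite n]

theorem eventually_posDef_of_isHermitian {A : Matrix n n ℝ} (hA : A.PosDef) :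
    ∀ᶠ M in nhds A, M.IsHermitian → M.PosDef := by
  have := Fintype.ofFinite n
  have h_sphere : ∀ᶠ M : Matrix n n ℝ in nhds A,
      ∀ x ∈ Metric.sphere (0 : n → ℝ) 1, 0 < x ⬝ᵥ M *ᵥ x := by
    refine (isCompact_sphere 0 1).eventually_forall_of_forall_eventually fun x hx => ?_
    have hx0 : x ≠ 0 := ne_zero_of_mem_unit_sphere ⟨x, hx⟩
    have h_cont : Continuous fun z : Matrix n n ℝ × (n → ℝ) => z.2 ⬝ᵥ z.1 *ᵥ z.2 :=
      continuous_snd.dotProduct (continuous_fst.matrix_mulVec continuous_snd)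
    exact h_cont.continuousAt.eventually_const_lt (hA.dotProduct_mulVec_pos hx0)
  filter_upwards [h_sphere] with M hM h_herm
  refine PosDef.of_dotProduct_mulVec_pos h_herm fun x hx => ?_
  have h_norm : 0 < ‖x‖ := norm_pos_iff.2 hx
  have h_unit := hM (‖x‖⁻¹ • x) (by simp [norm_smul, h_norm.ne'])
  rw [mulVec_smul, smul_dotProduct, dotProduct_smul, smul_smul, smul_eq_mul] at h_unit
  exact pos_of_mul_pos_right h_unit (by positivity)

theorem isClosed_setOf_posSemidef : IsClosed {A : Matrix n n ℝ | A.PosSemidef} := by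
  have := Fintype.ofFinite n
  simp only [posSemidef_iff_dotProduct_mulVec, Set.ofPred_and, Set.ofPred_forall]
  refine (isClosed_eq continuous_id.matrix_conjTranspose continuous_id).inter
    (isClosed_iInter fun x => isClosed_le continuous_const ?_)
  exact continuous_const.dotProduct (continuous_id.matrix_mulVec continuous_const)

end Finite

variable [Fintype n]

theorem trace_mul_nonneg_of_posSemidef {A B : Matrix n n ℝ} (hA : A.PosSemidef)
    (hB : B.PosSemidef) : 0 ≤ (A * B).trace := by
  obtain ⟨m, v, rfl⟩ := posSemidef_iff_eq_sum_vecMulVec.1 hA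
  rw [Finset.sum_mul, trace_sum]
  refine Finset.sum_nonneg fun i _ => ?_
  rw [trace_mul_comm, mul_vecMulVec, trace_vecMulVec, dotProduct_comm]
  exact hB.dotProduct_mulVec_nonneg _

theorem exists_pos_mul_trace_le_trace_mul {U : Matrix n n ℝ} (hU : U.PosDef) :
    ∃ c > 0, ∀ Ω : Matrix n n ℝ, Ω.PosSemidef → c * Ω.trace ≤ (Ω * U).trace := by
  classical
  have h_cont : Continuous fun c : ℝ => U - c • (1 : Matrix n n ℝ) := by fun_prop
  have h_tendsto : Filter.Tendsto (fun c : ℝ => U - c • (1 : Matrix n n ℝ)) (nhds 0) (nhds U) :=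
    h_cont.tendsto' 0 U (by rw [zero_smul, sub_zero])
  have h_pos := (h_tendsto.eventually (eventually_posDef_of_isHermitian hU)).filter_mono
    (nhdsWithin_le_nhds (s := Set.Ioi 0))
  obtain ⟨c, hc, hc_pos⟩ := (h_pos.and self_mem_nhdsWithin).exists
  have h_posDef := hc (hU.isHermitian.sub (isHermitian_one.smul (.all c)))
  refine ⟨c, hc_pos, fun Ω hΩ => ?_⟩
  have h_nonneg := trace_mul_nonneg_of_posSemidef hΩ h_posDef.posSemidef
  rwa [Matrix.mul_sub, Matrix.mul_smul, Matrix.mul_one, trace_sub, trace_smul, smul_eq_mul,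
    sub_nonneg] at h_nonneg

theorem diag_le_trace {A : Matrix n n ℝ} (hA : A.PosSemidef) (i : n) : A i i ≤ A.trace :=
  Finset.single_le_sum (f := fun i => A i i) (fun _ _ => hA.diag_nonneg) (Finset.mem_univ i)

theorem abs_apply_le_trace {A : Matrix n n ℝ} (hA : A.PosSemidef) (i j : n) :
    |A i j| ≤ A.trace := by
  classical
  have h_symm : A j i = A i j := hA.isHermitian.apply i j
  have h_form (s : ℝ) (hs : s * s = 1) : 0 ≤ A i i + A j j + 2 * s * A i j := by
    have h := hA.dotProduct_mulVec_nonneg (Pi.single i 1 + s • Pi.single j 1)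
    simp only [star_trivial, mulVec_add, mulVec_single, MulOpposite.op_one, one_smul, mulVec_smul,
      dotProduct_add, add_dotProduct, single_dotProduct, col_apply, one_mul, smul_dotProduct,
      h_symm, smul_eq_mul, dotProduct_smul] at h
    linear_combination h + A j j * hs
  have h_add := h_form 1 (by norm_num)
  have h_sub := h_form (-1) (by norm_num)
  have hi := diag_le_trace hA i
  have hj := diag_le_trace hA j
  exact abs_le.2 ⟨by linarith, by linarith⟩

theorem abs_adjugate_apply_le [DecidableEq n] {A : Matrix n n ℝ} {x : ℝ} (hx : 1 ≤ x)
    (hA : ∀ i j, |A i j| ≤ x) (i j : n) :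
    |A.adjugate i j| ≤ (Fintype.card n).factorial * x ^ Fintype.card n := by
  rw [adjugate_apply, ← nsmul_eq_mul]
  refine det_le (abv := AbsoluteValue.abs) fun k l => ?_
  rw [updateRow_apply, AbsoluteValue.abs_apply]
  split_ifs
  · have h_single : |(Pi.single i 1 : n → ℝ) l| ≤ 1 := by
      rw [Pi.single_apply]
      split_ifs <;> norm_num
    exact h_single.trans hx
  · exact hA k l

theorem setOf_posDef_eq [DecidableEq n] :
    {A : Matrix n n ℝ | A.PosDef} = {A | A.PosSemidef} ∩ {A | A.det ≠ 0} := by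
  ext A
  exact ⟨fun h => ⟨h.posSemidef, h.det_pos.ne'⟩, fun h => h.1.posDef_iff_det_ne_zero.2 h.2⟩

end PosDef

/-! ### Directional derivative of the determinant -/

theorem eval_det_one_add_X_smul {n R : Type*} [Fintype n] [DecidableEq n] [CommRing R]
    (M : Matrix n n R) (t : R) :
    (det (1 + (Polynomial.X : Polynomial R) • M.map Polynomial.C)).eval t = (1 + t • M).det := by
  rw [← Polynomial.coe_evalRingHom, RingHom.map_det]
  congr 1
  ext i j
  simpa [one_apply, apply_ite] using mul_comm (M i j) t

theorem hasDerivAt_det_add_smul {n : Type*} [Fintype n] [DecidableEq n] (A E : Matrix n n ℝ)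
    (hA : IsUnit A.det) :
    HasDerivAt (fun t : ℝ => (A + t • E).det) (A.det * (A⁻¹ * E).trace) 0 := by
  have h_poly (t : ℝ) : (A + t • E).det = A.det *
      (det (1 + (Polynomial.X : Polynomial ℝ) • (A⁻¹ * E).map Polynomial.C)).eval t := by
    have h_factor : A + t • E = A * (1 + t • (A⁻¹ * E)) := by
      rw [Matrix.mul_add, Matrix.mul_one, Matrix.mul_smul, ← Matrix.mul_assoc,
        Matrix.mul_nonsing_inv _ hA, Matrix.one_mul]
    rw [h_factor, det_mul, eval_det_one_add_X_smul]
  simp only [h_poly, ← derivative_det_one_add_X_smul]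
  exact (Polynomial.hasDerivAt _ 0).const_mul _

/-! ### Padded inverses and the score -/

section PaddedInv

variable {p : ℕ} (δ : Fin p → ℝ) (Ω E U : Matrix (Fin p) (Fin p) ℝ)

theorem trace_mul_paddedInv (k : Fin p) :
    (E * paddedInv Ω k).trace = ((leadingSub Ω k)⁻¹ * leadingSub E k).trace := by
  rw [trace_mul_comm (leadingSub Ω k)⁻¹]
  simp only [trace, diag_apply, mul_apply]
  refine (Fintype.sum_of_injective _ Subtype.val_injective _ _ (fun i hi => ?_) fun i =>
    Fintype.sum_of_injective _ Subtype.val_injective _ _ (fun j hj => ?_) fun j => ?_).symm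
  · have hik : ¬ i ≤ k := fun h => hi ⟨⟨i, h⟩, rfl⟩
    exact Finset.sum_eq_zero fun j _ => by
      rw [paddedInv, of_apply, dif_neg fun h => hik h.2, mul_zero]
  · have hjk : ¬ j ≤ k := fun h => hj ⟨⟨j, h⟩, rfl⟩
    rw [paddedInv, of_apply, dif_neg fun h => hjk h.1, mul_zero]
  · rw [paddedInv, of_apply, dif_pos ⟨j.2, i.2⟩]
    rfl

theorem trace_mul_sigmaStar : (E * sigmaStar δ Ω).trace =
    ∑ k, (δ k - nextShape δ k) * (E * paddedInv Ω k).trace := by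
  simp only [sigmaStar, Matrix.mul_sum, Matrix.mul_smul, trace_sum, trace_smul, smul_eq_mul]

variable {Ω}

theorem hasDerivAt_log_det_leadingSub (hΩ : Ω.PosDef) (k : Fin p) :
    HasDerivAt (fun t : ℝ => Real.log (leadingSub (Ω + t • E) k).det)
      (E * paddedInv Ω k).trace 0 := by
  have h_det : (leadingSub Ω k).det ≠ 0 := (posDef_leadingSub hΩ k).det_pos.ne'
  have h_deriv : HasDerivAt (fun t : ℝ => (leadingSub (Ω + t • E) k).det)
      ((leadingSub Ω k).det * (E * paddedInv Ω k).trace) 0 := by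
    rw [trace_mul_paddedInv]
    exact hasDerivAt_det_add_smul (leadingSub Ω k) (leadingSub E k) h_det.isUnit
  have h_log := h_deriv.log (by rwa [zero_smul, add_zero])
  rwa [zero_smul, add_zero, mul_div_cancel_left₀ _ h_det] at h_log

theorem hasDerivAt_wishartLogDensity (hΩ : Ω.PosDef) :
    HasDerivAt (fun t : ℝ => wishartLogDensity U δ (Ω + t • E))
      (1 / 2 * (E * (sigmaStar δ Ω - U)).trace) 0 := by
  have h_minors := HasDerivAt.fun_sum (u := Finset.univ) fun k _ =>
    (hasDerivAt_log_det_leadingSub E hΩ k).const_mul ((δ k - nextShape δ k) / 2)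
  have h_trace : HasDerivAt (fun t : ℝ => ((Ω + t • E) * U).trace) (E * U).trace 0 := by
    simp only [Matrix.add_mul, Matrix.smul_mul, trace_add, trace_smul, smul_eq_mul]
    exact (hasDerivAt_mul_const _).const_add _
  refine (h_minors.fun_sub (h_trace.const_mul (1 / 2))).congr_deriv ?_
  rw [Matrix.mul_sub, trace_sub, trace_mul_sigmaStar, mul_sub, Finset.mul_sum]
  exact congrArg (· - _) (Finset.sum_congr rfl fun k _ => by ring)

theorem isHermitian_paddedInv (hΩ : Ω.IsHermitian) (k : Fin p) : (paddedInv Ω k).IsHermitian := by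
  have h_inv : (leadingSub Ω k)⁻¹.IsHermitian := (hΩ.submatrix _).inv
  ext i j
  rw [conjTranspose_apply, star_trivial, paddedInv, of_apply, of_apply]
  by_cases h : i ≤ k ∧ j ≤ k
  · rw [dif_pos h, dif_pos h.symm]
    exact h_inv.apply _ _
  · rw [dif_neg h, dif_neg fun h' => h h'.symm]

theorem isHermitian_sigmaStar (hΩ : Ω.IsHermitian) : (sigmaStar δ Ω).IsHermitian := by
  rw [IsHermitian, sigmaStar, conjTranspose_sum]
  refine Finset.sum_congr rfl fun k _ => ?_
  rw [conjTranspose_smul, star_trivial, (isHermitian_paddedInv hΩ k).eq]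

theorem paddedInv_last {m : ℕ} (Ω : Matrix (Fin (m + 1)) (Fin (m + 1)) ℝ) :
    paddedInv Ω (Fin.last m) = Ω⁻¹ := by
  let e : {i : Fin (m + 1) // i ≤ Fin.last m} ≃ Fin (m + 1) :=
    Equiv.subtypeUnivEquiv fun i => Fin.le_last i
  ext i j
  rw [paddedInv, of_apply, dif_pos ⟨Fin.le_last i, Fin.le_last j⟩]
  exact congrFun₂ (inv_submatrix_equiv Ω e e) (e.symm i) (e.symm j)

theorem sigmaStar_of_forall_eq {d : ℝ} (hδ : ∀ k, δ k = d) : sigmaStar δ Ω = d • Ω⁻¹ := by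
  obtain _ | m := p
  · exact Subsingleton.elim _ _
  have h_last : nextShape δ (Fin.last m) = 0 := dif_neg (lt_irrefl (m + 1))
  have h_next (k : Fin (m + 1)) (hk : k ≠ Fin.last m) : nextShape δ k = d := by
    rw [nextShape, dif_pos (Nat.succ_lt_succ (Fin.val_lt_last hk)), hδ]
  rw [sigmaStar, Finset.sum_eq_single (Fin.last m), h_last, hδ, sub_zero, paddedInv_last]
  · intro k _ hk
    rw [h_next k hk, hδ, sub_self, zero_smul]
  · exact fun h => (h (Finset.mem_univ _)).elim

theorem abs_det_mul_paddedInv_apply_le {x : ℝ} (hx : 1 ≤ x) (hΩ : Ω.PosDef)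
    (hx_le : ∀ i j, |Ω i j| ≤ x) (k i j : Fin p) :
    |(leadingSub Ω k).det * paddedInv Ω k i j| ≤ p.factorial * x ^ p := by
  rw [paddedInv, of_apply]
  split_ifs with h
  · rw [inv_def, Ring.inverse_eq_inv', Matrix.smul_apply, smul_eq_mul,
      mul_inv_cancel_left₀ (posDef_leadingSub hΩ k).det_pos.ne']
    have h_card : Fintype.card {i : Fin p // i ≤ k} ≤ p := by
      simpa only [Fintype.card_fin] using Fintype.card_subtype_le (· ≤ k)
    refine (abs_adjugate_apply_le (A := leadingSub Ω k) hx (fun a b => hx_le a b) _ _).trans ?_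
    gcongr
  · rw [mul_zero, abs_zero]
    positivity

end PaddedInv

/-! ### Measurability -/

section Measurability

variable {p : ℕ}

instance matrixBorelSpace : BorelSpace (Matrix (Fin p) (Fin p) ℝ) :=
  inferInstanceAs (BorelSpace (Fin p → Fin p → ℝ))

theorem measurableSet_setOf_posDef :
    MeasurableSet {A : Matrix (Fin p) (Fin p) ℝ | A.PosDef} := by
  rw [setOf_posDef_eq]
  exact isClosed_setOf_posSemidef.measurableSet.inter
    (isOpen_ne_fun continuous_id.matrix_det continuous_const).measurableSet

theorem measurableSet_PDCone (H : SimpleGraph (Fin p)) : MeasurableSet (PDCone H) := by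
  have h_zero : MeasurableSet {A : Matrix (Fin p) (Fin p) ℝ |
      ∀ i j, i ≠ j → ¬ H.Adj i j → A i j = 0} := by
    simp only [Set.ofPred_forall]
    exact .iInter fun i => .iInter fun j => .iInter fun _ => .iInter fun _ =>
      (isClosed_eq (continuous_id.matrix_elem i j) continuous_const).measurableSet
  exact measurableSet_setOf_posDef.inter h_zero

theorem continuous_leadingSub (k : Fin p) :
    Continuous fun Ω : Matrix (Fin p) (Fin p) ℝ => leadingSub Ω k :=
  continuous_id.matrix_submatrix Subtype.val Subtype.val

theorem measurable_paddedInv_apply (k i j : Fin p) :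
    Measurable fun Ω : Matrix (Fin p) (Fin p) ℝ => paddedInv Ω k i j := by
  simp only [paddedInv, of_apply]
  split_ifs with h
  · simp only [inv_def, Ring.inverse_eq_inv', Matrix.smul_apply, smul_eq_mul]
    exact (continuous_leadingSub k).matrix_det.measurable.inv.mul
      ((continuous_leadingSub k).matrix_adjugate.matrix_elem _ _).measurable
  · exact measurable_const

theorem measurable_sigmaStar_apply (δ : Fin p → ℝ) (i j : Fin p) :
    Measurable fun Ω : Matrix (Fin p) (Fin p) ℝ => sigmaStar δ Ω i j := by
  simp only [sigmaStar, Matrix.sum_apply, Matrix.smul_apply, smul_eq_mul]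
  exact Finset.measurable_fun_sum _ fun k _ => (measurable_paddedInv_apply k i j).const_mul _

theorem measurable_wishartLogDensity (U : Matrix (Fin p) (Fin p) ℝ) (δ : Fin p → ℝ) :
    Measurable (wishartLogDensity U δ) := by
  have h_trace : Continuous fun Ω : Matrix (Fin p) (Fin p) ℝ => (Ω * U).trace :=
    (continuous_id.matrix_mul continuous_const).matrix_trace
  refine (Finset.measurable_fun_sum _ fun k _ => ?_).sub (h_trace.measurable.const_mul _)
  exact (continuous_leadingSub k).matrix_det.measurable.log.const_mul _

end Measurability

/-! ### Matrices in free entries -/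

section FreeEntries

variable {p : ℕ} (H : SimpleGraph (Fin p))

theorem ofFree_add_smul (x v : FreePos H → ℝ) (t : ℝ) :
    ofFree H (x + t • v) = ofFree H x + t • ofFree H v := by
  ext i j
  simp only [ofFree, of_apply, Matrix.add_apply, Matrix.smul_apply, smul_eq_mul]
  split_ifs
  exacts [rfl, rfl, by ring]

theorem continuous_ofFree : Continuous (ofFree H) := by
  refine continuous_matrix fun i j => ?_
  simp only [ofFree, of_apply]
  split_ifs
  exacts [continuous_apply _, continuous_apply _, continuous_const]

theorem ofFree_apply_val (x : FreePos H → ℝ) (q : FreePos H) :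
    ofFree H x q.1.1 q.1.2 = x q := by
  rw [ofFree, of_apply, dif_pos q.2]
  rfl

theorem isHermitian_ofFree (x : FreePos H → ℝ) : (ofFree H x).IsHermitian := by
  ext i j
  rw [conjTranspose_apply, star_trivial, ofFree, of_apply, of_apply]
  by_cases hij : i ≤ j ∧ (j = i ∨ H.Adj j i)
  · by_cases hji : j ≤ i ∧ (i = j ∨ H.Adj i j)
    · obtain rfl : i = j := le_antisymm hij.1 hji.1
      rfl
    · rw [dif_pos hij, dif_neg hji, dif_pos hij]
  · by_cases hji : j ≤ i ∧ (i = j ∨ H.Adj i j)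
    · rw [dif_neg hij, dif_pos hji, dif_pos hji]
    · rw [dif_neg hij, dif_neg hji, dif_neg hji, dif_neg hij]

theorem ofFree_apply_eq_zero (x : FreePos H → ℝ) {i j : Fin p} (hij : i ≠ j)
    (h_adj : ¬ H.Adj i j) : ofFree H x i j = 0 := by
  rw [ofFree, of_apply, dif_neg, dif_neg]
  · exact fun h => h.2.elim hij.symm fun h' => h_adj h'.symm
  · exact fun h => h.2.elim hij h_adj

theorem ofFree_mem_PDCone_iff (x : FreePos H → ℝ) :
    ofFree H x ∈ PDCone H ↔ (ofFree H x).PosDef :=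
  ⟨And.left, fun h => ⟨h, fun _ _ hij h_adj => ofFree_apply_eq_zero H x hij h_adj⟩⟩

theorem ofFree_eq_graphPart {A : Matrix (Fin p) (Fin p) ℝ} (hA : A.IsHermitian) :
    ofFree H (fun q => A q.1.1 q.1.2) = graphPart H A := by
  have h_symm (i j : Fin p) : A i j = A j i := (hA.apply i j).symm
  ext i j
  rw [graphPart, of_apply]
  split_ifs with hij
  · rcases le_total j i with hji | hij'
    · exact ofFree_apply_val H _ ⟨(i, j), hji, hij⟩
    · rw [← (isHermitian_ofFree H _).apply, h_symm]
      exact ofFree_apply_val H _ ⟨(j, i), hij', hij.imp Eq.symm SimpleGraph.Adj.symm⟩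
  · rw [not_or] at hij
    exact ofFree_apply_eq_zero H _ hij.1 hij.2

theorem graphPart_one : graphPart H 1 = 1 := by
  ext i j
  rw [graphPart, of_apply]
  split_ifs with hij
  · rfl
  · exact (one_apply_ne fun h => hij (.inl h)).symm

theorem graphPart_sub (A B : Matrix (Fin p) (Fin p) ℝ) :
    graphPart H (A - B) = graphPart H A - graphPart H B := by
  ext i j
  simp only [graphPart, of_apply, Matrix.sub_apply]
  split_ifs
  exacts [rfl, (sub_zero 0).symm]

theorem trace_graphPart_mul (A B : Matrix (Fin p) (Fin p) ℝ) :
    (graphPart H A * B).trace = (graphPart H A * graphPart H B).trace := by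
  simp only [trace, diag_apply, mul_apply, graphPart, of_apply]
  refine Finset.sum_congr rfl fun i _ => Finset.sum_congr rfl fun j _ => ?_
  by_cases hij : i = j ∨ H.Adj i j
  · rw [if_pos hij, if_pos (hij.imp Eq.symm SimpleGraph.Adj.symm)]
  · rw [if_neg hij, zero_mul, zero_mul]

theorem graphPart_eq_zero_of_forall_trace_ofFree_mul {A : Matrix (Fin p) (Fin p) ℝ}
    (hA : A.IsHermitian) (h : ∀ v, (ofFree H v * A).trace = 0) : graphPart H A = 0 := by
  have h_herm : (graphPart H A).IsHermitian := by
    rw [← ofFree_eq_graphPart H hA]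
    exact isHermitian_ofFree H _
  rw [← trace_conjTranspose_mul_self_eq_zero_iff, h_herm.eq, ← trace_graphPart_mul,
    ← ofFree_eq_graphPart H hA]
  exact h _

theorem isOpen_setOf_posDef_ofFree : IsOpen {x | (ofFree H x).PosDef} := by
  refine isOpen_iff_eventually.2 fun x hx => ?_
  filter_upwards [(continuous_ofFree H).continuousAt.eventually
    (eventually_posDef_of_isHermitian hx)] with y hy
  exact hy (isHermitian_ofFree H y)

theorem nonempty_setOf_posDef_ofFree : {x | (ofFree H x).PosDef}.Nonempty := by
  refine ⟨fun q => (1 : Matrix (Fin p) (Fin p) ℝ) q.1.1 q.1.2, ?_⟩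
  rw [Set.mem_ofPred_eq, ofFree_eq_graphPart H isHermitian_one, graphPart_one]
  exact PosDef.one

theorem norm_le_trace_ofFree {x : FreePos H → ℝ} (hx : (ofFree H x).PosSemidef) :
    ‖x‖ ≤ (ofFree H x).trace := by
  refine (pi_norm_le_iff_of_nonneg hx.trace_nonneg).2 fun q => ?_
  rw [← ofFree_apply_val H x q]
  exact abs_apply_le_trace hx _ _

end FreeEntries

/-! ### The density in free entries -/

theorem exists_forall_pow_mul_exp_neg_le (N : ℕ) {c : ℝ} (hc : 0 < c) :
    ∃ M, ∀ T : ℝ, 0 ≤ T → (1 + T) ^ N * Real.exp (-(c * T)) ≤ M := by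
  refine ⟨N.factorial / c ^ N * Real.exp c, fun T hT => ?_⟩
  have h_pow := Real.pow_div_factorial_le_exp (c * (1 + T)) (by positivity) N
  rw [div_le_iff₀ (by positivity), mul_pow, mul_add, mul_one, Real.exp_add] at h_pow
  rw [Real.exp_neg, ← div_eq_mul_inv, div_le_iff₀ (Real.exp_pos _), div_mul_eq_mul_div,
    div_mul_eq_mul_div, le_div_iff₀ (by positivity)]
  linarith

theorem prod_choleskyD_rpow_le {p : ℕ} {s : Fin p → ℝ} (hs : ∀ i, 0 ≤ s i)
    {Ω : Matrix (Fin p) (Fin p) ℝ} (hΩ : Ω.PosDef) :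
    ∏ i, choleskyD Ω i ^ s i ≤ (1 + Ω.trace) ^ ∑ i, s i := by
  have h_trace := hΩ.posSemidef.trace_nonneg
  rw [Real.rpow_sum_of_pos (by positivity)]
  refine Finset.prod_le_prod (fun i _ => Real.rpow_nonneg (choleskyD_pos hΩ i).le _) fun i _ =>
    Real.rpow_le_rpow (choleskyD_pos hΩ i).le ?_ (hs i)
  linarith [choleskyD_le_diag hΩ i, diag_le_trace hΩ.posSemidef i]

theorem exists_forall_wishartDensity_mul_pow_le {p : ℕ} {U : Matrix (Fin p) (Fin p) ℝ}
    (hU : U.PosDef) {δ : Fin p → ℝ} (hδ : ∀ i, 0 ≤ δ i) (N : ℕ) :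
    ∃ M, ∀ Ω, Ω.PosDef → wishartDensity U δ Ω * (1 + Ω.trace) ^ N ≤ M := by
  obtain ⟨c, hc, h_trace⟩ := exists_pos_mul_trace_le_trace_mul hU
  obtain ⟨M, hM⟩ := exists_forall_pow_mul_exp_neg_le (⌈∑ i, δ i / 2⌉₊ + N) (half_pos hc)
  refine ⟨M, fun Ω hΩ => le_trans ?_ (hM Ω.trace hΩ.posSemidef.trace_nonneg)⟩
  have hT := hΩ.posSemidef.trace_nonneg
  have h_prod : ∏ i, choleskyD Ω i ^ (δ i / 2) ≤ (1 + Ω.trace) ^ ⌈∑ i, δ i / 2⌉₊ := by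
    refine (prod_choleskyD_rpow_le (fun i => div_nonneg (hδ i) zero_le_two) hΩ).trans ?_
    rw [← Real.rpow_natCast]
    exact Real.rpow_le_rpow_of_exponent_le (by linarith) (Nat.le_ceil _)
  have h_exp : -(1 / 2) * (Ω * U).trace ≤ -(c / 2 * Ω.trace) := by
    linarith [h_trace Ω hΩ.posSemidef]
  rw [wishartDensity, mul_right_comm, pow_add]
  gcongr

/-- The density `wishartDensity U δ` as a function of the free entries, extended by zero outside
the cone of positive definite matrices. -/
noncomputable def coneDensity {p : ℕ} (H : SimpleGraph (Fin p)) (U : Matrix (Fin p) (Fin p) ℝ)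
    (δ : Fin p → ℝ) : (FreePos H → ℝ) → ℝ :=
  Set.indicator {x | (ofFree H x).PosDef} fun x => wishartDensity U δ (ofFree H x)

section ConeDensity

variable {p : ℕ} {H : SimpleGraph (Fin p)} {U : Matrix (Fin p) (Fin p) ℝ} {δ : Fin p → ℝ}
  {x : FreePos H → ℝ}

theorem coneDensity_of_posDef (hx : (ofFree H x).PosDef) :
    coneDensity H U δ x = wishartDensity U δ (ofFree H x) :=
  Set.indicator_of_mem (s := {x | (ofFree H x).PosDef}) hx _

theorem coneDensity_of_not_posDef (hx : ¬ (ofFree H x).PosDef) : coneDensity H U δ x = 0 :=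
  Set.indicator_of_notMem (s := {x | (ofFree H x).PosDef}) hx _

theorem coneDensity_nonneg (x : FreePos H → ℝ) : 0 ≤ coneDensity H U δ x :=
  Set.indicator_nonneg (fun _ hx => (wishartDensity_pos U δ hx).le) x

theorem measurable_coneDensity : Measurable (coneDensity H U δ) := by
  have h_exp : coneDensity H U δ = Set.indicator {x | (ofFree H x).PosDef} fun x =>
      Real.exp (wishartLogDensity U δ (ofFree H x)) :=
    Set.indicator_congr fun x hx => wishartDensity_eq_exp U δ hx
  rw [h_exp]
  exact ((measurable_wishartLogDensity U δ).comp (measurable_ofFree H)).exp.indicator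
    (isOpen_setOf_posDef_ofFree H).measurableSet

theorem integrable_coneDensity_mul (hU : U.PosDef) (hδ : ∀ i, 0 ≤ δ i)
    {φ : Matrix (Fin p) (Fin p) ℝ → ℝ} (hφ : Measurable φ) {K : ℝ} {N : ℕ}
    (hφ_le : ∀ Ω, Ω.PosDef → |φ Ω| ≤ K * (1 + Ω.trace) ^ N) :
    Integrable fun x => coneDensity H U δ x * φ (ofFree H x) := by
  set r : ℕ := Module.finrank ℝ (FreePos H → ℝ) + 1
  obtain ⟨M, hM⟩ := exists_forall_wishartDensity_mul_pow_le hU hδ (N + r)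
  have h_int : Integrable fun x : FreePos H → ℝ => (1 + ‖x‖) ^ (-(r : ℝ)) :=
    integrable_one_add_norm (by exact_mod_cast Nat.lt_succ_self _)
  refine (h_int.const_mul |K * M|).mono'
    (measurable_coneDensity.mul (hφ.comp (measurable_ofFree H))).aestronglyMeasurable
    (.of_forall fun x => ?_)
  rw [Real.rpow_neg (by positivity), Real.rpow_natCast, ← div_eq_mul_inv]
  by_cases hx : (ofFree H x).PosDef
  · have hT := hx.posSemidef.trace_nonneg
    have hK : 0 ≤ K := nonneg_of_mul_nonneg_left ((abs_nonneg _).trans (hφ_le _ hx)) (by positivity)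
    have h_norm := norm_le_trace_ofFree H hx.posSemidef
    have h_pos := wishartDensity_pos U δ hx
    rw [coneDensity_of_posDef hx, norm_mul, Real.norm_of_nonneg h_pos.le, Real.norm_eq_abs,
      le_div_iff₀ (by positivity)]
    set Ω := ofFree H x
    calc wishartDensity U δ Ω * |φ Ω| * (1 + ‖x‖) ^ r
        ≤ wishartDensity U δ Ω * (K * (1 + Ω.trace) ^ N) * (1 + Ω.trace) ^ r := by
          gcongr
          exact hφ_le Ω hx
      _ = K * (wishartDensity U δ Ω * (1 + Ω.trace) ^ (N + r)) := by ring
      _ ≤ K * M := mul_le_mul_of_nonneg_left (hM Ω hx) hK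
      _ ≤ |K * M| := le_abs_self _
  · rw [coneDensity_of_not_posDef hx, zero_mul, norm_zero]
    positivity

theorem integrable_coneDensity (hU : U.PosDef) (hδ : ∀ i, 0 ≤ δ i) :
    Integrable (coneDensity H U δ) := by
  have h := integrable_coneDensity_mul (H := H) hU hδ (measurable_const (a := (1 : ℝ)))
    (K := 1) (N := 0) fun Ω _ => by rw [abs_one, pow_zero, one_mul]
  simpa only [mul_one] using h

theorem integral_coneDensity_pos (hU : U.PosDef) (hδ : ∀ i, 0 ≤ δ i) :
    0 < ∫ x, coneDensity H U δ x := by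
  rw [integral_pos_iff_support_of_nonneg coneDensity_nonneg (integrable_coneDensity hU hδ)]
  refine ((isOpen_setOf_posDef_ofFree H).measure_pos volume
    (nonempty_setOf_posDef_ofFree H)).trans_le (measure_mono fun x hx => ?_)
  rw [Function.mem_support, coneDensity_of_posDef hx]
  exact (wishartDensity_pos U δ hx).ne'

theorem integrable_coneDensity_mul_paddedInv (hU : U.PosDef) (hδ : ∀ i, 2 ≤ δ i)
    (k i j : Fin p) : Integrable fun x => coneDensity H U δ x * paddedInv (ofFree H x) k i j := by
  set s : Fin p → ℝ := fun i => if i ≤ k then 1 else 0 with hs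
  -- Since `det Ω_k = ∏ i ≤ k, D_i`, the pole of `Ω_k⁻¹` is absorbed by lowering `δ` by `2 s`.
  have h_absorb (x : FreePos H → ℝ) : coneDensity H U δ x * paddedInv (ofFree H x) k i j =
      coneDensity H U (fun i => δ i - 2 * s i) x *
        ((leadingSub (ofFree H x) k).det * paddedInv (ofFree H x) k i j) := by
    by_cases hx : (ofFree H x).PosDef
    · have h_det : ∏ i, choleskyD (ofFree H x) i ^ s i = (leadingSub (ofFree H x) k).det := by
        rw [det_leadingSub_eq_prod_choleskyD hx]
        refine Finset.prod_congr rfl fun i _ => ?_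
        rw [hs, pow_ite, Real.rpow_one, Real.rpow_zero]
      rw [coneDensity_of_posDef hx, coneDensity_of_posDef hx,
        wishartDensity_eq_prod_rpow_mul U δ s hx, h_det]
      ring
    · rw [coneDensity_of_not_posDef hx, coneDensity_of_not_posDef hx, zero_mul, zero_mul]
  simp only [h_absorb]
  refine integrable_coneDensity_mul hU (fun i => ?_)
    (φ := fun Ω => (leadingSub Ω k).det * paddedInv Ω k i j)
    ((continuous_leadingSub k).matrix_det.measurable.mul (measurable_paddedInv_apply k i j))
    (K := p.factorial) (N := p) fun Ω hΩ => ?_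
  · have := hδ i
    rw [hs]
    dsimp only
    split_ifs <;> linarith
  · have hT := hΩ.posSemidef.trace_nonneg
    exact abs_det_mul_paddedInv_apply_le (by linarith) hΩ
      (fun a b => (abs_apply_le_trace hΩ.posSemidef a b).trans (by linarith)) k i j

theorem integrable_coneDensity_mul_sigmaStar (hU : U.PosDef) (hδ : ∀ i, 2 ≤ δ i) (i j : Fin p) :
    Integrable fun x => coneDensity H U δ x * sigmaStar δ (ofFree H x) i j := by
  simp only [sigmaStar, Matrix.sum_apply, Matrix.smul_apply, smul_eq_mul, Finset.mul_sum,
    mul_left_comm (coneDensity H U δ _)]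
  exact integrable_finsetSum _ fun k _ =>
    (integrable_coneDensity_mul_paddedInv hU hδ k i j).const_mul _

theorem exists_coneDensity_le_mul_abs_det_rpow (hU : U.PosDef) {s : ℝ} (hδ : ∀ i, 2 * s ≤ δ i) :
    ∃ K, ∀ x, coneDensity H U δ x ≤ K * |(ofFree H x).det| ^ s := by
  obtain ⟨K, hK⟩ := exists_forall_wishartDensity_mul_pow_le hU (δ := fun i => δ i - 2 * s)
    (fun i => sub_nonneg.2 (hδ i)) 0
  simp only [pow_zero, mul_one] at hK
  refine ⟨K, fun x => ?_⟩
  by_cases hx : (ofFree H x).PosDef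
  · rw [coneDensity_of_posDef hx, wishartDensity_eq_prod_rpow_mul U δ (fun _ => s) hx,
      Real.finsetProd_rpow _ _ fun i _ => (choleskyD_pos hx i).le, ← det_eq_prod_choleskyD hx,
      abs_of_pos hx.det_pos, mul_comm K]
    exact mul_le_mul_of_nonneg_left (hK _ hx) (Real.rpow_nonneg hx.det_pos.le _)
  · rw [coneDensity_of_not_posDef hx]
    exact mul_nonneg ((wishartDensity_pos U _ PosDef.one).le.trans (hK 1 PosDef.one))
      (Real.rpow_nonneg (abs_nonneg _) _)

end ConeDensity

/-! ### The score of the density -/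

theorem hasDerivAt_zero_of_norm_le_mul_abs_rpow {F : Type*} [NormedAddCommGroup F]
    [NormedSpace ℝ F] {f : ℝ → F} {g : ℝ → ℝ} {a g' K s : ℝ} (hs : 1 < s)
    (hg : HasDerivAt g g' a) (hga : g a = 0) (hfg : ∀ᶠ t in nhds a, ‖f t‖ ≤ K * |g t| ^ s) :
    HasDerivAt f 0 a := by
  have h_rpow := ((hasDerivAt_abs_rpow (g a) hs).comp a hg).isLittleO
  have h_zero : |g a| ^ s = 0 := by rw [hga, abs_zero, Real.zero_rpow (by linarith)]
  have hfa : f a = 0 := norm_le_zero_iff.1 (by simpa only [h_zero, mul_zero] using hfg.self_of_nhds)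
  rw [hga, mul_zero, zero_mul] at h_rpow
  rw [hasDerivAt_iff_isLittleO]
  simp only [Function.comp_apply, smul_zero, sub_zero, hfa, h_zero] at h_rpow ⊢
  exact (Asymptotics.IsBigO.of_norm_eventuallyLE hfg).trans_isLittleO (h_rpow.const_mul_left K)

theorem integral_eq_zero_of_hasLineDerivAt {E : Type*} [NormedAddCommGroup E] [NormedSpace ℝ E]
    [FiniteDimensional ℝ E] [MeasurableSpace E] [BorelSpace E] {μ : Measure E}
    [μ.IsAddHaarMeasure] {f f' : E → ℝ} {v : E} (hf : Integrable f μ) (hf' : Integrable f' μ)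
    (h : ∀ x, HasLineDerivAt ℝ f (f' x) x v) : ∫ x, f' x ∂μ = 0 := by
  have h_parts := integral_bilinear_hasLineDerivAt_right_eq_neg_left_of_integrable (μ := μ)
    (f := fun _ : E => (1 : ℝ)) (f' := fun _ => 0) (g := f) (g' := f') (v := v)
    (B := ContinuousLinearMap.mul ℝ ℝ) (by simp) (by simpa using hf') (by simpa using hf)
    (fun _ _ => hasDerivAt_const 0 1) (fun x _ => h x)
  simpa using h_parts

theorem integrable_trace_mul {S : Type*} [MeasurableSpace S] {P : Measure S} {p : ℕ}
    (E : Matrix (Fin p) (Fin p) ℝ) {M : S → Matrix (Fin p) (Fin p) ℝ}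
    (hM : ∀ i j, Integrable (fun s => M s i j) P) : Integrable (fun s => (E * M s).trace) P := by
  simp only [trace, diag_apply, mul_apply]
  exact integrable_finsetSum _ fun i _ => integrable_finsetSum _ fun j _ => (hM j i).const_mul _

theorem integral_trace_mul {S : Type*} [MeasurableSpace S] {P : Measure S} {p : ℕ}
    (E : Matrix (Fin p) (Fin p) ℝ) {M : S → Matrix (Fin p) (Fin p) ℝ}
    (hM : ∀ i j, Integrable (fun s => M s i j) P) :
    ∫ s, (E * M s).trace ∂P = (E * matrixExpectation P M).trace := by
  have h_int (i j : Fin p) : Integrable (fun s => E i j * M s j i) P := (hM j i).const_mul _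
  simp only [trace, diag_apply, mul_apply, matrixExpectation, of_apply]
  rw [integral_finsetSum _ fun i _ => integrable_finsetSum _ fun j _ => h_int i j]
  simp only [integral_finsetSum _ fun j _ => h_int _ j, integral_const_mul]

theorem exists_one_lt_forall_two_mul_le {ι : Type*} [Finite ι] {δ : ι → ℝ} (hδ : ∀ i, 2 < δ i) :
    ∃ s : ℝ, 1 < s ∧ ∀ i, 2 * s ≤ δ i := by
  have h_near : ∀ᶠ s : ℝ in nhdsWithin 1 (Set.Ioi 1), 1 < s ∧ ∀ i, 2 * s ≤ δ i :=
    eventually_mem_nhdsWithin.and <| Filter.eventually_all.2 fun i =>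
      eventually_nhdsWithin_of_eventually_nhds <|
        (eventually_lt_nhds (by linarith [hδ i] : 1 < δ i / 2)).mono fun s hs => by linarith
  exact h_near.exists

section Score

variable {p : ℕ} {H : SimpleGraph (Fin p)} {U : Matrix (Fin p) (Fin p) ℝ} {δ : Fin p → ℝ}
  {x : FreePos H → ℝ}

theorem hasLineDerivAt_coneDensity_of_posDef (hx : (ofFree H x).PosDef) (v : FreePos H → ℝ) :
    HasLineDerivAt ℝ (coneDensity H U δ) (coneDensity H U δ x *
      (1 / 2 * (ofFree H v * (sigmaStar δ (ofFree H x) - U)).trace)) x v := by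
  have h_near : ∀ᶠ t : ℝ in nhds 0, (ofFree H (x + t • v)).PosDef := by
    refine (Continuous.tendsto' (by fun_prop) 0 x ?_).eventually
      ((isOpen_setOf_posDef_ofFree H).mem_nhds hx)
    rw [zero_smul, add_zero]
  have h_exp := (hasDerivAt_wishartLogDensity δ (ofFree H v) U hx).exp
  rw [zero_smul, add_zero, ← wishartDensity_eq_exp U δ hx, ← coneDensity_of_posDef hx] at h_exp
  refine h_exp.congr_of_eventuallyEq (h_near.mono fun t ht => ?_)
  simp only [coneDensity_of_posDef ht]
  rw [wishartDensity_eq_exp U δ ht, ofFree_add_smul]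

theorem hasLineDerivAt_coneDensity_of_det_eq_zero (hU : U.PosDef) (hδ : ∀ i, 2 < δ i)
    (hx : (ofFree H x).det = 0) (v : FreePos H → ℝ) :
    HasLineDerivAt ℝ (coneDensity H U δ) 0 x v := by
  obtain ⟨s, hs, hsδ⟩ := exists_one_lt_forall_two_mul_le hδ
  obtain ⟨K, hK⟩ := exists_coneDensity_le_mul_abs_det_rpow (H := H) hU hsδ
  have h_diff : DifferentiableAt ℝ (fun t : ℝ => (ofFree H (x + t • v)).det) 0 := by
    simp only [ofFree_add_smul, det_apply, Matrix.add_apply, Matrix.smul_apply]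
    fun_prop
  refine hasDerivAt_zero_of_norm_le_mul_abs_rpow (K := K) hs h_diff.hasDerivAt ?_
    (.of_forall fun t => ?_)
  · rw [zero_smul, add_zero, hx]
  · rw [Real.norm_of_nonneg (coneDensity_nonneg _)]
    exact hK _

theorem hasLineDerivAt_coneDensity_of_not_posSemidef (hx : ¬ (ofFree H x).PosSemidef)
    (v : FreePos H → ℝ) : HasLineDerivAt ℝ (coneDensity H U δ) 0 x v := by
  have h_open : IsOpen {y | ¬ (ofFree H y).PosSemidef} :=
    (isClosed_setOf_posSemidef.preimage (continuous_ofFree H)).isOpen_compl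
  have h_near : ∀ᶠ t : ℝ in nhds 0, ¬ (ofFree H (x + t • v)).PosSemidef := by
    refine (Continuous.tendsto' (by fun_prop) 0 x ?_).eventually (h_open.mem_nhds hx)
    rw [zero_smul, add_zero]
  exact (hasDerivAt_const 0 0).congr_of_eventuallyEq <| h_near.mono fun t ht =>
    coneDensity_of_not_posDef fun h => ht h.posSemidef

theorem hasLineDerivAt_coneDensity (hU : U.PosDef) (hδ : ∀ i, 2 < δ i) (x v : FreePos H → ℝ) :
    HasLineDerivAt ℝ (coneDensity H U δ) (coneDensity H U δ x *
      (1 / 2 * (ofFree H v * (sigmaStar δ (ofFree H x) - U)).trace)) x v := by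
  by_cases hx : (ofFree H x).PosDef
  · exact hasLineDerivAt_coneDensity_of_posDef hx v
  rw [coneDensity_of_not_posDef hx, zero_mul]
  by_cases hx_psd : (ofFree H x).PosSemidef
  · have h_det : (ofFree H x).det = 0 := by_contra fun h => hx (hx_psd.posDef_iff_det_ne_zero.2 h)
    exact hasLineDerivAt_coneDensity_of_det_eq_zero hU hδ h_det v
  · exact hasLineDerivAt_coneDensity_of_not_posSemidef hx_psd v

end Score

/-! ### The generalized G-Wishart law -/

theorem withDensity_map {α β : Type*} [MeasurableSpace α] [MeasurableSpace β] {μ : Measure α}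
    {f : α → β} (hf : Measurable f) {g : β → ENNReal} (hg : Measurable g) :
    (μ.map f).withDensity g = (μ.withDensity (g ∘ f)).map f := by
  ext s hs
  rw [withDensity_apply _ hs, setLIntegral_map hs hg hf, Measure.map_apply hf hs,
    withDensity_apply _ (hf hs)]
  rfl

section Law

variable {p : ℕ} {H : SimpleGraph (Fin p)} {U : Matrix (Fin p) (Fin p) ℝ} {δ : Fin p → ℝ}

theorem wishartMeasure_eq_map : wishartMeasure H U δ =
    (volume.withDensity fun x => ENNReal.ofReal (coneDensity H U δ x)).map (ofFree H) := by
  set g : Matrix (Fin p) (Fin p) ℝ → ENNReal :=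
    fun Ω => ENNReal.ofReal (Real.exp (wishartLogDensity U δ Ω))
  have hg : Measurable g := (measurable_wishartLogDensity U δ).exp.ennreal_ofReal
  have h_cone := measurableSet_PDCone H
  have h_free := measurable_ofFree H
  calc wishartMeasure H U δ
      = ((freeLebesgue H).restrict (PDCone H)).withDensity g := by
        refine withDensity_congr_ae ?_
        filter_upwards [ae_restrict_mem h_cone] with Ω hΩ
        rw [wishartDensity_eq_exp U δ hΩ.1]
    _ = (volume.withDensity ((ofFree H ⁻¹' PDCone H).indicator (g ∘ ofFree H))).map (ofFree H) := by
        rw [freeLebesgue, Measure.restrict_map h_free h_cone, withDensity_map h_free hg,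
          withDensity_indicator (h_free h_cone)]
    _ = _ := by
        congr 2
        funext x
        by_cases hx : (ofFree H x).PosDef
        · rw [Set.indicator_of_mem (s := ofFree H ⁻¹' PDCone H)
            ((ofFree_mem_PDCone_iff H x).2 hx), coneDensity_of_posDef hx,
            wishartDensity_eq_exp U δ hx]
          rfl
        · rw [Set.indicator_of_notMem (s := ofFree H ⁻¹' PDCone H)
            (mt (ofFree_mem_PDCone_iff H x).1 hx),
            coneDensity_of_not_posDef hx, ENNReal.ofReal_zero]

theorem wishartMeasure_univ (hU : U.PosDef) (hδ : ∀ i, 0 ≤ δ i) :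
    wishartMeasure H U δ Set.univ = ENNReal.ofReal (∫ x, coneDensity H U δ x) := by
  rw [wishartMeasure_eq_map, Measure.map_apply (measurable_ofFree H) .univ, Set.preimage_univ,
    withDensity_apply _ .univ, Measure.restrict_univ, ofReal_integral_eq_lintegral_ofReal
      (integrable_coneDensity hU hδ) (.of_forall coneDensity_nonneg)]

theorem isProbabilityMeasure_genGWishart (hU : U.PosDef) (hδ : ∀ i, 0 ≤ δ i) :
    IsProbabilityMeasure (genGWishart H U δ) := by
  refine ⟨?_⟩
  rw [genGWishart, Measure.smul_apply, smul_eq_mul, wishartMeasure_univ hU hδ]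
  exact ENNReal.inv_mul_cancel (ENNReal.ofReal_pos.2 (integral_coneDensity_pos hU hδ)).ne'
    ENNReal.ofReal_ne_top

variable {φ : Matrix (Fin p) (Fin p) ℝ → ℝ}

theorem integrable_genGWishart_iff (hU : U.PosDef) (hδ : ∀ i, 0 ≤ δ i) (hφ : Measurable φ) :
    Integrable φ (genGWishart H U δ) ↔
      Integrable fun x => coneDensity H U δ x * φ (ofFree H x) := by
  rw [genGWishart, wishartMeasure_univ hU hδ, integrable_smul_measure
    (ENNReal.inv_ne_zero.2 ENNReal.ofReal_ne_top)
    (ENNReal.inv_ne_top.2 (ENNReal.ofReal_pos.2 (integral_coneDensity_pos hU hδ)).ne'),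
    wishartMeasure_eq_map, integrable_map_measure hφ.aestronglyMeasurable
    (measurable_ofFree H).aemeasurable, integrable_withDensity_iff_integrable_smul'
    measurable_coneDensity.ennreal_ofReal (.of_forall fun _ => ENNReal.ofReal_lt_top)]
  simp only [ENNReal.toReal_ofReal (coneDensity_nonneg _), smul_eq_mul, Function.comp_apply]

theorem integral_genGWishart (hU : U.PosDef) (hδ : ∀ i, 0 ≤ δ i) (hφ : Measurable φ) :
    ∫ Ω, φ Ω ∂genGWishart H U δ =
      (∫ x, coneDensity H U δ x)⁻¹ * ∫ x, coneDensity H U δ x * φ (ofFree H x) := by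
  rw [genGWishart, integral_smul_measure, wishartMeasure_univ hU hδ, ENNReal.toReal_inv,
    ENNReal.toReal_ofReal (integral_coneDensity_pos hU hδ).le, smul_eq_mul, wishartMeasure_eq_map,
    integral_map (measurable_ofFree H).aemeasurable hφ.aestronglyMeasurable,
    integral_withDensity_eq_integral_toReal_smul measurable_coneDensity.ennreal_ofReal
      (.of_forall fun _ => ENNReal.ofReal_lt_top)]
  simp only [ENNReal.toReal_ofReal (coneDensity_nonneg _), smul_eq_mul]

theorem ae_posDef_genGWishart : ∀ᵐ Ω ∂genGWishart H U δ, Ω.PosDef := by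
  have h_restrict : ∀ᵐ Ω ∂(freeLebesgue H).restrict (PDCone H), Ω.PosDef :=
    (ae_restrict_mem (measurableSet_PDCone H)).mono fun Ω hΩ => hΩ.1
  exact Measure.ae_smul_measure ((withDensity_absolutelyContinuous _ _).ae_le h_restrict) _

theorem integrable_sigmaStar_apply (hU : U.PosDef) (hδ : ∀ i, 2 ≤ δ i) (i j : Fin p) :
    Integrable (fun Ω => sigmaStar δ Ω i j) (genGWishart H U δ) :=
  (integrable_genGWishart_iff hU (fun i => zero_le_two.trans (hδ i))
    (measurable_sigmaStar_apply δ i j)).2 (integrable_coneDensity_mul_sigmaStar hU hδ i j)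

theorem integrable_sigmaStar_sub_apply (hU : U.PosDef) (hδ : ∀ i, 2 ≤ δ i) (i j : Fin p) :
    Integrable (fun Ω => (sigmaStar δ Ω - U) i j) (genGWishart H U δ) :=
  haveI := isProbabilityMeasure_genGWishart (H := H) hU fun i => zero_le_two.trans (hδ i)
  (integrable_sigmaStar_apply hU hδ i j).sub (integrable_const _)

theorem measurable_trace_mul_sigmaStar_sub (E : Matrix (Fin p) (Fin p) ℝ) :
    Measurable fun Ω => (E * (sigmaStar δ Ω - U)).trace := by
  simp only [trace, diag_apply, mul_apply, Matrix.sub_apply]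
  exact Finset.measurable_fun_sum _ fun i _ => Finset.measurable_fun_sum _ fun j _ =>
    ((measurable_sigmaStar_apply δ j i).sub_const _).const_mul _

theorem integral_trace_ofFree_mul_sigmaStar_sub (hU : U.PosDef) (hδ : ∀ i, 2 < δ i)
    (v : FreePos H → ℝ) :
    ∫ Ω, (ofFree H v * (sigmaStar δ Ω - U)).trace ∂genGWishart H U δ = 0 := by
  have hδ_nonneg (i : Fin p) : 0 ≤ δ i := zero_le_two.trans (hδ i).le
  have h_meas := measurable_trace_mul_sigmaStar_sub (U := U) (δ := δ) (ofFree H v)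
  have h_int := (integrable_genGWishart_iff (H := H) hU hδ_nonneg h_meas).1
    (integrable_trace_mul _ (integrable_sigmaStar_sub_apply hU fun i => (hδ i).le))
  have h_score := integral_eq_zero_of_hasLineDerivAt (integrable_coneDensity hU hδ_nonneg)
    ((h_int.const_mul (1 / 2)).congr (.of_forall fun x => mul_left_comm _ _ _))
    fun x => hasLineDerivAt_coneDensity hU hδ x v
  simp only [mul_left_comm _ (1 / 2 : ℝ), integral_const_mul] at h_score
  rw [integral_genGWishart hU hδ_nonneg h_meas,
    (mul_eq_zero.1 h_score).resolve_left one_half_pos.ne', mul_zero]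

theorem graphPart_matrixExpectation_sigmaStar (hU : U.PosDef) (hδ : ∀ i, 2 < δ i) :
    graphPart H (matrixExpectation (genGWishart H U δ) (sigmaStar δ)) = graphPart H U := by
  have := isProbabilityMeasure_genGWishart (H := H) hU fun i => zero_le_two.trans (hδ i).le
  have h_int := integrable_sigmaStar_apply (H := H) hU fun i => (hδ i).le
  have h_sub : matrixExpectation (genGWishart H U δ) (fun Ω => sigmaStar δ Ω - U) =
      matrixExpectation (genGWishart H U δ) (sigmaStar δ) - U := by
    ext i j
    simp only [matrixExpectation, of_apply, Matrix.sub_apply]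
    rw [integral_sub (h_int i j) (integrable_const _), integral_const, probReal_univ, one_smul]
  have h_herm : (matrixExpectation (genGWishart H U δ) (sigmaStar δ) - U).IsHermitian := by
    refine IsHermitian.sub (ext fun i j => integral_congr_ae ?_) hU.isHermitian
    filter_upwards [ae_posDef_genGWishart] with Ω hΩ
    exact (isHermitian_sigmaStar δ hΩ.isHermitian).apply i j
  refine sub_eq_zero.1 ((graphPart_sub H _ _).symm.trans ?_)
  refine graphPart_eq_zero_of_forall_trace_ofFree_mul H h_herm fun v => ?_
  rw [← h_sub, ← integral_trace_mul _ (integrable_sigmaStar_sub_apply hU fun i => (hδ i).le)]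
  exact integral_trace_ofFree_mul_sigmaStar_sub hU hδ v

end Law

theorem graphPart_eq_graphPart_iff {p : ℕ} {H : SimpleGraph (Fin p)}
    {A B : Matrix (Fin p) (Fin p) ℝ} :
    graphPart H A = graphPart H B ↔ ∀ i j, i = j ∨ H.Adj i j → A i j = B i j := by
  simp only [← Matrix.ext_iff, graphPart, of_apply]
  refine forall₂_congr fun i j => ⟨fun h hij => ?_, fun h => ?_⟩
  · rwa [if_pos hij, if_pos hij] at h
  · split_ifs with hij
    exacts [h hij, rfl]

theorem mainTheorem4_general {p : ℕ} (H : SimpleGraph (Fin p))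
    (U : Matrix (Fin p) (Fin p) ℝ) (hU : U.PosDef) (δ : Fin p → ℝ) (hδ : ∀ k, 2 < δ k)
    {S : Type*} [MeasurableSpace S] (P : Measure S) (Ω : S → Matrix (Fin p) (Fin p) ℝ)
    (hΩ : HasLaw Ω (genGWishart H U δ) P) :
    IsProbabilityMeasure (genGWishart H U δ) ∧
    (∀ i j, Integrable (fun s => sigmaStar δ (Ω s) i j) P) ∧
    graphPart H (matrixExpectation P fun s => sigmaStar δ (Ω s)) = graphPart H U ∧
    ∀ d : ℝ, (∀ k, δ k = d) → ∀ i j, i = j ∨ H.Adj i j →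
      Integrable (fun s => (Ω s)⁻¹ i j) P ∧ ∫ s, (Ω s)⁻¹ i j ∂P = U i j / d := by
  have h_meas (i j : Fin p) := (measurable_sigmaStar_apply δ i j).aestronglyMeasurable
    (μ := genGWishart H U δ)
  have h_int (i j : Fin p) : Integrable (fun s => sigmaStar δ (Ω s) i j) P :=
    (hΩ.map_eq.symm ▸ integrable_sigmaStar_apply hU (fun k => (hδ k).le) i j :
      Integrable (fun A => sigmaStar δ A i j) (P.map Ω)).comp_aemeasurable hΩ.aemeasurable
  have h_mean : graphPart H (matrixExpectation P fun s => sigmaStar δ (Ω s)) = graphPart H U := by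
    rw [← graphPart_matrixExpectation_sigmaStar hU hδ]
    congr 1
    exact ext fun i j => hΩ.integral_comp (h_meas i j)
  refine ⟨isProbabilityMeasure_genGWishart hU fun k => zero_le_two.trans (hδ k).le, h_int, h_mean,
    fun d hd i j hij => ?_⟩
  have hd0 : d ≠ 0 := hd i ▸ (zero_lt_two.trans (hδ i)).ne'
  have h_inv (s : S) : (Ω s)⁻¹ i j = d⁻¹ * sigmaStar δ (Ω s) i j := by
    rw [sigmaStar_of_forall_eq δ hd, Matrix.smul_apply, smul_eq_mul, inv_mul_cancel_left₀ hd0]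
  have h_entry : ∫ s, sigmaStar δ (Ω s) i j ∂P = U i j :=
    graphPart_eq_graphPart_iff.1 h_mean i j hij
  simp only [h_inv]
  exact ⟨(h_int i j).const_mul _, by rw [integral_const_mul, h_entry, div_eq_inv_mul]⟩

theorem mainTheorem4 {V : Type*} (G : SimpleGraph V) {p : ℕ} (σ : V ≃ Fin p)
    (U : Matrix (Fin p) (Fin p) ℝ) (hU : U.PosDef)
    (δ : Fin p → ℝ) (hδ : ∀ k, 4 < δ k)
    {S : Type*} [MeasurableSpace S] (P : Measure S)
    (Ω : S → Matrix (Fin p) (Fin p) ℝ)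
    (hΩ : HasLaw Ω (genGWishart (orderedGraph G σ) U δ) P) :
    IsProbabilityMeasure (genGWishart (orderedGraph G σ) U δ) ∧
    (∀ i j, Integrable (fun s => sigmaStar δ (Ω s) i j) P) ∧
    graphPart (orderedGraph G σ) (matrixExpectation P fun s => sigmaStar δ (Ω s)) =
      graphPart (orderedGraph G σ) U ∧
    ∀ d : ℝ, (∀ k, δ k = d) →
      ∀ i j, i = j ∨ (orderedGraph G σ).Adj i j →
        Integrable (fun s => (Ω s)⁻¹ i j) P ∧ ∫ s, (Ω s)⁻¹ i j ∂P = U i j / d :=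
  mainTheorem4_general (orderedGraph G σ) U hU δ (fun k => by linarith [hδ k]) P Ω hΩ
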